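/- Let $\Omega\subseteq\mathbb{R}^n$ be open, $N\ge 0$ and $p\ge 1$ integers, $D=-i\partial$, and let $$P=\sum_{j=1}^N X_j^*f^pX_j+iX_0+a_0,$$ where, for $0\le j\le N$, $X_j=X_j(x,D)=\sum_{k=1}^n b_{j,k}(x)D_k$ is a homogeneous first order differential operator with real-valued coefficients $b_{j,k}\in C^\infty(\Omega;\mathbb{R})$ (that is, $iX_j$ is a smooth real vector field on $\Omega$), $X_j^*$ is the formal $L^2$-adjoint of $X_j$, $a_0\in C^\infty(\Omega;\mathbb{C})$, and $f\in C^\infty(\Omega;\mathbb{R})$ is such that $S:=f^{-1}(0)\neq\emptyset$ and $df\neq 0$ at every point of $S$. Suppose that for every $x_0\in\Omega\setminus S$ there is $j_0\in\{1,\dots,N\}$ such that the vector field $iX_{j_0}$ does not vanish at $x_0$. Then $P$ is $L^2$ to $L^2$ locally solvable in $\Omega\setminus S$. That is, for every $x_0\in\Omega\setminus S$ there is a compact set $K\subset\Omega$, with $x_0$ in its interior $U=\mathring K$, such that for every $v\in L^2_{\mathrm{loc}}(\Omega)$ there is $u\in L^2_{\mathrm{loc}}(\Omega)$ with $Pu=v$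 in $U$ in the sense of distributions, i.e. $(u,P^*\varphi)=(v,\varphi)$ for all $\varphi\in C_0^\infty(U)$, where $(\cdot,\cdot)$ is the $L^2$ inner product and $P^*=\sum_{j=1}^N X_j^*f^pX_j-iX_0^*+\overline{a_0}$ is the formal adjoint of $P$. -/

import Mathlib

open MeasureTheory Set
open scoped ContDiff ComplexConjugate

noncomputable section

namespace DegenerateSolvability

/-- `ℝⁿ` with its Euclidean structure and Lebesgue measure. -/
abbrev E (n : ℕ) : Type := EuclideanSpace ℝ (Fin n)

/-- `φ ∈ C₀^∞(U)`: a smooth complex function with compact support contained in `U`. -/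
structure IsTestFunction {n : ℕ} (U : Set (E n)) (φ : E n → ℂ) : Prop where
  smooth : ContDiff ℝ ∞ φ
  compact : HasCompactSupport φ
  supp : tsupport φ ⊆ U

/-- `u ∈ L²_loc(Ω)`: `u` is square integrable on every compact subset of `Ω`. -/
def IsL2Loc {n : ℕ} (Ω : Set (E n)) (u : E n → ℂ) : Prop :=
  ∀ K : Set (E n), IsCompact K → K ⊆ Ω → MemLp u 2 (volume.restrict K)

/-- The homogeneous first order operator `X(x,D) = ∑ₖ bₖ(x) Dₖ`, `D = -i∂`, with real coefficient
vector `b`; its symbol is the real function `∑ₖ bₖ(x) ξₖ`, and `iX = ∑ₖ bₖ ∂ₖ` is the real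
vector field `b`. -/
def firstOrder {n : ℕ} (b : E n → E n) (u : E n → ℂ) : E n → ℂ :=
  fun x => -Complex.I * fderiv ℝ u x (b x)

/-- The formal `L²`-adjoint `X* u = ∑ₖ Dₖ (bₖ u)` of `X(x,D) = ∑ₖ bₖ(x) Dₖ` (`b` real). -/
def firstOrderAdj {n : ℕ} (b : E n → E n) (u : E n → ℂ) : E n → ℂ :=
  fun x => -Complex.I *
    ∑ k : Fin n, fderiv ℝ (fun y => ((b y k : ℝ) : ℂ) * u y) x (EuclideanSpace.single k 1)

/-- The data of an operator `P = ∑_{j=1}^N Xⱼ* f^p Xⱼ + iX₀ + a₀` on an open set `Ω ⊆ ℝⁿ`.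
The coefficient functions are total functions of which only the values on `Ω` matter. -/
structure DegenerateOperator (n N : ℕ) where
  /-- the domain -/
  Ω : Set (E n)
  isOpen : IsOpen Ω
  /-- the exponent -/
  p : ℕ
  one_le_p : 1 ≤ p
  /-- the real coefficient vectors of `X₀, X₁, …, X_N`, that is, the real vector fields `iXⱼ` -/
  b : Fin (N + 1) → E n → E n
  b_smooth : ∀ j, ContDiffOn ℝ ∞ (b j) Ω
  /-- the zero order term -/
  a₀ : E n → ℂ
  a₀_smooth : ContDiffOn ℝ ∞ a₀ Ω
  /-- the degeneracy function -/
  f : E n → ℝ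
  f_smooth : ContDiffOn ℝ ∞ f Ω
  zero_nonempty : ∃ x ∈ Ω, f x = 0
  df_ne_zero : ∀ x ∈ Ω, f x = 0 → fderiv ℝ f x ≠ 0

namespace DegenerateOperator

variable {n N : ℕ}

/-- The zero set `S = f⁻¹(0)` of `f : Ω → ℝ`. -/
def S (P : DegenerateOperator n N) : Set (E n) := {x ∈ P.Ω | P.f x = 0}

/-- The action of `P = ∑_{j=1}^N Xⱼ* f^p Xⱼ + iX₀ + a₀` on smooth functions. -/
def op (P : DegenerateOperator n N) (u : E n → ℂ) : E n → ℂ := fun x =>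
  (∑ j : Fin N, firstOrderAdj (P.b j.succ)
    (fun y => ((P.f y : ℝ) : ℂ) ^ P.p * firstOrder (P.b j.succ) u y) x)
  + Complex.I * firstOrder (P.b 0) u x + P.a₀ x * u x

/-- The formal adjoint `P* = ∑_{j=1}^N Xⱼ* f^p Xⱼ - iX₀* + conj a₀`; the lemma
`integral_op_mul_conj` below checks that it is the formal `L²`-adjoint of `P`. -/
def adj (P : DegenerateOperator n N) (u : E n → ℂ) : E n → ℂ := fun x =>
  (∑ j : Fin N, firstOrderAdj (P.b j.succ)
    (fun y => ((P.f y : ℝ) : ℂ) ^ P.p * firstOrder (P.b j.succ) u y) x)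
  - Complex.I * firstOrderAdj (P.b 0) u x + conj (P.a₀ x) * u x

/-- `Pu = v` in the open set `U` in the sense of distributions:
`(u, P*φ) = (v, φ)` for all `φ ∈ C₀^∞(U)`. -/
def SolvesOn (P : DegenerateOperator n N) (U : Set (E n)) (u v : E n → ℂ) : Prop :=
  ∀ φ : E n → ℂ, IsTestFunction U φ →
    ∫ x, u x * conj (P.adj φ x) = ∫ x, v x * conj (φ x)

/-- `P` is `L²` to `L²` locally solvable at `x₀`. -/
def L2LocallySolvableAt (P : DegenerateOperator n N) (x₀ : E n) : Prop :=
  ∃ K : Set (E n), IsCompact K ∧ K ⊆ P.Ω ∧ x₀ ∈ interior K ∧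
    ∀ v : E n → ℂ, IsL2Loc P.Ω v →
      ∃ u : E n → ℂ, IsL2Loc P.Ω u ∧ P.SolvesOn (interior K) u v

/-- `P` is `L²` to `L²` locally solvable in `A`: it is so at each point of `A`. -/
def L2LocallySolvableIn (P : DegenerateOperator n N) (A : Set (E n)) : Prop :=
  ∀ x₀ ∈ A, P.L2LocallySolvableAt x₀

end DegenerateOperator

section Adjoint

variable {n N : ℕ} {Ω : Set (E n)}

theorem IsTestFunction.smul_coeff {φ g : E n → ℂ} (hΩ : IsOpen Ω) (hφ : IsTestFunction Ω φ)
    (hg : ContDiffOn ℝ ∞ g Ω) : IsTestFunction Ω (fun x => g x * φ x) := by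
  have hs : tsupport (fun x => g x * φ x) ⊆ tsupport φ := tsupport_mul_subset_right
  refine ⟨contDiff_iff_contDiffAt.2 fun x => ?_,
    hφ.compact.of_isClosed_subset (isClosed_tsupport _) hs, hs.trans hφ.supp⟩
  by_cases hx : x ∈ tsupport φ
  · exact (hg.contDiffAt (hΩ.mem_nhds (hφ.supp hx))).mul hφ.smooth.contDiffAt
  · refine (contDiffAt_const (c := (0 : ℂ))).congr_of_eventuallyEq ?_
    filter_upwards [(isClosed_tsupport φ).isOpen_compl.mem_nhds hx] with y hy
    rw [image_eq_zero_of_notMem_tsupport hy, mul_zero]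

theorem IsTestFunction.partial_deriv {φ : E n → ℂ} (hφ : IsTestFunction Ω φ) (v : E n) :
    IsTestFunction Ω (fun x => fderiv ℝ φ x v) :=
  ⟨(hφ.smooth.fderiv_right (m := ∞) (by simp)).clm_apply contDiff_const,
    hφ.compact.fderiv_apply ℝ v, (tsupport_fderiv_apply_subset ℝ v).trans hφ.supp⟩

theorem IsTestFunction.sum {ι : Type*} (s : Finset ι) {φ : ι → E n → ℂ}
    (hφ : ∀ i ∈ s, IsTestFunction Ω (φ i)) : IsTestFunction Ω (fun x => ∑ i ∈ s, φ i x) := by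
  have key : ∀ x, x ∉ ⋃ i ∈ s, tsupport (φ i) → ∑ i ∈ s, φ i x = 0 := by
    intro x hx
    refine Finset.sum_eq_zero fun i hi => image_eq_zero_of_notMem_tsupport fun h => hx ?_
    exact mem_biUnion hi h
  have hK : IsCompact (⋃ i ∈ s, tsupport (φ i)) :=
    s.isCompact_biUnion fun i hi => (hφ i hi).compact
  have hs : tsupport (fun x => ∑ i ∈ s, φ i x) ⊆ ⋃ i ∈ s, tsupport (φ i) :=
    closure_minimal (fun x hx => by by_contra h; exact hx (key x h)) hK.isClosed
  exact ⟨ContDiff.sum fun i hi => (hφ i hi).smooth,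
    hK.of_isClosed_subset (isClosed_tsupport _) hs,
    hs.trans (iUnion₂_subset fun i hi => (hφ i hi).supp)⟩

theorem IsTestFunction.conj {φ : E n → ℂ} (hφ : IsTestFunction Ω φ) :
    IsTestFunction Ω (fun x => conj (φ x)) :=
  ⟨Complex.conjCLE.contDiff.comp hφ.smooth, hφ.compact.comp_left (g := conj) (map_zero _),
    (tsupport_comp_subset (g := conj) (map_zero _) _).trans hφ.supp⟩

theorem IsTestFunction.integrable_mul {φ ψ : E n → ℂ} (hφ : IsTestFunction Ω φ)
    (hψ : IsTestFunction Ω ψ) : Integrable (fun x => φ x * ψ x) :=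
  (hφ.smooth.continuous.mul hψ.smooth.continuous).integrable_of_hasCompactSupport
    hψ.compact.mul_left

theorem contDiffOn_coeff {b : E n → E n} (hb : ContDiffOn ℝ ∞ b Ω) (k : Fin n) :
    ContDiffOn ℝ ∞ (fun y => ((b y k : ℝ) : ℂ)) Ω :=
  Complex.ofRealCLM.contDiff.comp_contDiffOn ((contDiffOn_euclidean.1 hb) k)

theorem fderiv_apply_eq_sum (φ : E n → ℂ) (x v : E n) :
    fderiv ℝ φ x v = ∑ k : Fin n, ((v k : ℝ) : ℂ) * fderiv ℝ φ x (EuclideanSpace.single k 1) := by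
  conv_lhs => rw [← (EuclideanSpace.basisFun (Fin n) ℝ).sum_repr v]
  simp [map_sum]

theorem IsTestFunction.firstOrder {b : E n → E n} {φ : E n → ℂ} (hΩ : IsOpen Ω)
    (hb : ContDiffOn ℝ ∞ b Ω) (hφ : IsTestFunction Ω φ) :
    IsTestFunction Ω (firstOrder b φ) := by
  have : DegenerateSolvability.firstOrder b φ = fun x => (-Complex.I) * ∑ k : Fin n,
      ((b x k : ℝ) : ℂ) * fderiv ℝ φ x (EuclideanSpace.single k 1) := by
    funext x
    rw [DegenerateSolvability.firstOrder, fderiv_apply_eq_sum]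
  rw [this]
  exact (IsTestFunction.sum _ fun k _ =>
    (hφ.partial_deriv _).smul_coeff hΩ (contDiffOn_coeff hb k)).smul_coeff hΩ contDiffOn_const

theorem IsTestFunction.firstOrderAdj {b : E n → E n} {φ : E n → ℂ} (hΩ : IsOpen Ω)
    (hb : ContDiffOn ℝ ∞ b Ω) (hφ : IsTestFunction Ω φ) :
    IsTestFunction Ω (firstOrderAdj b φ) :=
  (IsTestFunction.sum _ fun k _ =>
    (hφ.smul_coeff hΩ (contDiffOn_coeff hb k)).partial_deriv _).smul_coeff hΩ contDiffOn_const

/-- `X*` is the formal adjoint of `X`. -/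
theorem integral_firstOrder_mul_conj {b : E n → E n} {φ ψ : E n → ℂ} (hΩ : IsOpen Ω)
    (hb : ContDiffOn ℝ ∞ b Ω) (hφ : IsTestFunction Ω φ) (hψ : IsTestFunction Ω ψ) :
    ∫ x, firstOrder b φ x * conj (ψ x) = ∫ x, φ x * conj (firstOrderAdj b ψ x) := by
  have ht : ∀ k : Fin n, IsTestFunction Ω (fun x => ((b x k : ℝ) : ℂ) * ψ x) := fun k =>
    hψ.smul_coeff hΩ (contDiffOn_coeff hb k)
  have hconj : ∀ (k : Fin n) (x : E n),
      fderiv ℝ (fun y => conj (((b y k : ℝ) : ℂ) * ψ y)) x (EuclideanSpace.single k 1) =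
      conj (fderiv ℝ (fun y => ((b y k : ℝ) : ℂ) * ψ y) x (EuclideanSpace.single k 1)) := by
    intro k x
    have h := ((ht k).smooth.differentiable (by simp) x).hasFDerivAt
    have h2 := (Complex.conjCLE.toContinuousLinearMap.hasFDerivAt.comp x h).fderiv
    have h3 : (fun y => conj (((b y k : ℝ) : ℂ) * ψ y)) =
      (Complex.conjCLE.toContinuousLinearMap ∘ fun y => ((b y k : ℝ) : ℂ) * ψ y) := rfl
    rw [h3, h2]
    rfl
  have hparts : ∀ k : Fin n,
      ∫ x, fderiv ℝ φ x (EuclideanSpace.single k 1) * conj (((b x k : ℝ) : ℂ) * ψ x) =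
      - ∫ x, φ x *
        conj (fderiv ℝ (fun y => ((b y k : ℝ) : ℂ) * ψ y) x (EuclideanSpace.single k 1)) := by
    intro k
    have h := integral_mul_fderiv_eq_neg_fderiv_mul_of_integrable (μ := volume)
      (f := φ) (g := fun y => conj (((b y k : ℝ) : ℂ) * ψ y)) (v := EuclideanSpace.single k 1)
      ((hφ.partial_deriv _).integrable_mul (ht k).conj)
      (hφ.integrable_mul ((ht k).conj.partial_deriv _))
      (hφ.integrable_mul (ht k).conj)
      (fun x _ => hφ.smooth.differentiable (by simp) x)
      (fun x _ => (ht k).conj.smooth.differentiable (by simp) x)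
    simp only [hconj] at h
    rw [h, neg_neg]
  have hl : ∀ x, firstOrder b φ x * conj (ψ x) = ∑ k : Fin n, -Complex.I *
      (fderiv ℝ φ x (EuclideanSpace.single k 1) * conj (((b x k : ℝ) : ℂ) * ψ x)) := by
    intro x
    rw [firstOrder, fderiv_apply_eq_sum, mul_assoc, Finset.sum_mul, Finset.mul_sum]
    refine Finset.sum_congr rfl fun k _ => ?_
    rw [map_mul, Complex.conj_ofReal]
    ring
  have hr : ∀ x, φ x * conj (firstOrderAdj b ψ x) = ∑ k : Fin n, Complex.I *
      (φ x * conj (fderiv ℝ (fun y => ((b y k : ℝ) : ℂ) * ψ y) x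
        (EuclideanSpace.single k 1))) := by
    intro x
    rw [firstOrderAdj, map_mul, map_neg, Complex.conj_I, neg_neg, map_sum, Finset.mul_sum,
      Finset.mul_sum]
    exact Finset.sum_congr rfl fun k _ => by ring
  simp only [hl, hr]
  rw [integral_finsetSum _ fun k _ =>
      (((hφ.partial_deriv _).integrable_mul (ht k).conj).const_mul _),
    integral_finsetSum _ fun k _ =>
      ((hφ.integrable_mul ((ht k).partial_deriv _).conj).const_mul _)]
  refine Finset.sum_congr rfl fun k _ => ?_
  rw [integral_const_mul, integral_const_mul, hparts]
  ring

theorem integral_firstOrderAdj_mul_conj {b : E n → E n} {φ ψ : E n → ℂ} (hΩ : IsOpen Ω)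
    (hb : ContDiffOn ℝ ∞ b Ω) (hφ : IsTestFunction Ω φ) (hψ : IsTestFunction Ω ψ) :
    ∫ x, firstOrderAdj b φ x * conj (ψ x) = ∫ x, φ x * conj (firstOrder b ψ x) := by
  have h := congrArg (starRingEnd ℂ) (integral_firstOrder_mul_conj hΩ hb hψ hφ)
  rw [← integral_conj, ← integral_conj] at h
  simp only [map_mul, Complex.conj_conj] at h
  simpa only [mul_comm] using h.symm

/-- `P*` is the formal `L²`-adjoint of `P` on `Ω`. -/
theorem DegenerateOperator.integral_op_mul_conj (P : DegenerateOperator n N) {φ ψ : E n → ℂ}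
    (hφ : IsTestFunction P.Ω φ) (hψ : IsTestFunction P.Ω ψ) :
    ∫ x, P.op φ x * conj (ψ x) = ∫ x, φ x * conj (P.adj ψ x) := by
  have hO := P.isOpen
  have hf : ContDiffOn ℝ ∞ (fun y => ((P.f y : ℝ) : ℂ) ^ P.p) P.Ω :=
    (Complex.ofRealCLM.contDiff.comp_contDiffOn P.f_smooth).pow _
  have hX : ∀ {χ : E n → ℂ}, IsTestFunction P.Ω χ → ∀ j : Fin N, IsTestFunction P.Ω
      (fun y => ((P.f y : ℝ) : ℂ) ^ P.p * firstOrder (P.b j.succ) χ y) := fun hχ j =>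
    (hχ.firstOrder hO (P.b_smooth j.succ)).smul_coeff hO hf
  have hXX : ∀ {χ : E n → ℂ}, IsTestFunction P.Ω χ → ∀ j : Fin N, IsTestFunction P.Ω
      (firstOrderAdj (P.b j.succ)
        (fun y => ((P.f y : ℝ) : ℂ) ^ P.p * firstOrder (P.b j.succ) χ y)) := fun hχ j =>
    (hX hχ j).firstOrderAdj hO (P.b_smooth j.succ)
  have h1 : ∀ j : Fin N, ∫ x, firstOrderAdj (P.b j.succ)
        (fun y => ((P.f y : ℝ) : ℂ) ^ P.p * firstOrder (P.b j.succ) φ y) x * conj (ψ x) =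
      ∫ x, φ x * conj (firstOrderAdj (P.b j.succ)
        (fun y => ((P.f y : ℝ) : ℂ) ^ P.p * firstOrder (P.b j.succ) ψ y) x) := by
    intro j
    rw [integral_firstOrderAdj_mul_conj hO (P.b_smooth j.succ) (hX hφ j) hψ,
      ← integral_firstOrder_mul_conj hO (P.b_smooth j.succ) hφ (hX hψ j)]
    refine integral_congr_ae (Filter.Eventually.of_forall fun x => ?_)
    simp only [map_mul, map_pow, Complex.conj_ofReal]
    ring
  have h0 := integral_firstOrder_mul_conj hO (P.b_smooth 0) hφ hψ
  have hl : ∀ x, P.op φ x * conj (ψ x) = (∑ j : Fin N, firstOrderAdj (P.b j.succ)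
        (fun y => ((P.f y : ℝ) : ℂ) ^ P.p * firstOrder (P.b j.succ) φ y) x * conj (ψ x))
      + Complex.I * (firstOrder (P.b 0) φ x * conj (ψ x)) + (P.a₀ x * φ x) * conj (ψ x) := by
    intro x
    rw [DegenerateOperator.op, add_mul, add_mul, Finset.sum_mul]
    ring
  have hr : ∀ x, φ x * conj (P.adj ψ x) = (∑ j : Fin N, φ x * conj (firstOrderAdj (P.b j.succ)
        (fun y => ((P.f y : ℝ) : ℂ) ^ P.p * firstOrder (P.b j.succ) ψ y) x))
      + Complex.I * (φ x * conj (firstOrderAdj (P.b 0) ψ x))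
      + (P.a₀ x * φ x) * conj (ψ x) := by
    intro x
    simp only [DegenerateOperator.adj, map_add, map_sub, map_mul, Complex.conj_I,
      Complex.conj_conj, map_sum, ← Finset.mul_sum]
    ring
  have ha := ((hφ.smul_coeff hO P.a₀_smooth).integrable_mul hψ.conj)
  have hi1 := ((hφ.firstOrder hO (P.b_smooth 0)).integrable_mul hψ.conj).const_mul Complex.I
  have hi2 := (hφ.integrable_mul (hψ.firstOrderAdj hO (P.b_smooth 0)).conj).const_mul Complex.I
  have hs1 : ∀ j ∈ (Finset.univ : Finset (Fin N)), _ := fun j _ =>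
    (hXX hφ j).integrable_mul hψ.conj
  have hs2 : ∀ j ∈ (Finset.univ : Finset (Fin N)), _ := fun j _ =>
    hφ.integrable_mul (hXX hψ j).conj
  have e1 := (integral_add' ((integrable_finsetSum _ hs1).add hi1) ha).trans
    (congrArg (· + _) (integral_add' (integrable_finsetSum _ hs1) hi1))
  have e2 := (integral_add' ((integrable_finsetSum _ hs2).add hi2) ha).trans
    (congrArg (· + _) (integral_add' (integrable_finsetSum _ hs2) hi2))
  simp only [Pi.add_apply] at e1 e2
  simp only [hl, hr]
  rw [e1, e2, integral_finsetSum _ hs1, integral_finsetSum _ hs2, integral_const_mul,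
    integral_const_mul, h0]
  simp only [h1]

end Adjoint

end DegenerateSolvability

end

/-!
Off `S` the operator is no longer degenerate in the directions `Xⱼ`: near `x₀ ∉ S` the weight `f^p`
has a constant sign and is bounded away from zero. Solvability follows from the a priori estimate
`‖φ‖ ≤ C ‖P*φ‖` for `φ ∈ C₀^∞(U)`, with `U` a small ball around `x₀`.

Both ingredients of the estimate rest on `IsTestFunction.two_mul_im_integral_firstOrder`: for a
real vector field `b = iX` and a real multiplier `ψ`, integration by parts gives
`2 Im (ψXφ, φ) = ∫ (b·∇ψ + ψ div b) |φ|²`.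
* With `ψ = 1` it shows that `iX₀` contributes only a term of order zero to `Re (P*φ, φ)`. Up to
  such terms this real part is `∑ⱼ ∫ f^p |Xⱼφ|²`, so that it controls `‖X_{j₀}φ‖²` up to
  `O(‖φ‖²)` (`DegenerateOperator.re_integral_adj_mul_conj`).
* With `ψ(x) = ⟨b(x₀), x - x₀⟩`, where `b = iX_{j₀}` does not vanish at `x₀`, the derivative `b·∇ψ`
  is bounded below while `ψ` is as small as the radius of the ball. This is a Poincaré inequality
  `‖φ‖² ≤ ε ‖X_{j₀}φ‖²`, where `ε` tends to zero with the radius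
  (`IsTestFunction.mul_integral_norm_sq_le_firstOrder`).

On a small enough ball the `O(‖φ‖²)` terms are absorbed
(`DegenerateOperator.exists_apriori_estimate`). The solution `u` then comes from extending the
functional `P*φ ↦ (φ, v)` by Hahn-Banach and representing it by the Riesz theorem
(`exists_inner_eq_of_norm_le`).
-/

namespace DegenerateSolvability

variable {n N : ℕ} {U : Set (E n)}

/-! ### Weighted integrals of test functions -/

theorem IsTestFunction.integrable_weight_mul_norm_sq {φ : E n → ℂ} {g : E n → ℝ} (hU : IsOpen U)
    (hφ : IsTestFunction U φ) (hg : ContDiffOn ℝ ∞ g U) :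
    Integrable (fun x => g x * ‖φ x‖ ^ 2) := by
  have h := ((hφ.smul_coeff hU
    (Complex.ofRealCLM.contDiff.comp_contDiffOn hg)).integrable_mul hφ.conj).re
  refine h.congr (Filter.Eventually.of_forall fun x => ?_)
  simp only [Function.comp_apply, Complex.ofRealCLM_apply, mul_assoc, Complex.mul_conj']
  norm_cast

theorem IsTestFunction.integrable_norm_sq {φ : E n → ℂ} (hU : IsOpen U)
    (hφ : IsTestFunction U φ) : Integrable (fun x => ‖φ x‖ ^ 2) := by
  simpa using hφ.integrable_weight_mul_norm_sq hU (g := fun _ => 1) contDiffOn_const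

theorem IsTestFunction.eq_zero {φ : E n → ℂ} (hφ : IsTestFunction U φ) {x : E n} (hx : x ∉ U) :
    φ x = 0 :=
  image_eq_zero_of_notMem_tsupport fun h => hx (hφ.supp h)

theorem IsTestFunction.integral_weight_mul_norm_sq_le {φ : E n → ℂ} {g h : E n → ℝ}
    (hU : IsOpen U) (hφ : IsTestFunction U φ) (hg : ContDiffOn ℝ ∞ g U)
    (hh : ContDiffOn ℝ ∞ h U) (hgh : ∀ x ∈ U, g x ≤ h x) :
    ∫ x, g x * ‖φ x‖ ^ 2 ≤ ∫ x, h x * ‖φ x‖ ^ 2 := by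
  refine integral_mono (hφ.integrable_weight_mul_norm_sq hU hg)
    (hφ.integrable_weight_mul_norm_sq hU hh) fun x => ?_
  by_cases hx : x ∈ U
  · exact mul_le_mul_of_nonneg_right (hgh x hx) (sq_nonneg _)
  · simp [hφ.eq_zero hx]

theorem IsTestFunction.abs_integral_weight_mul_norm_sq_le {φ : E n → ℂ} {g : E n → ℝ} {M : ℝ}
    (hU : IsOpen U) (hφ : IsTestFunction U φ) (hg : ContDiffOn ℝ ∞ g U)
    (hM : ∀ x ∈ U, |g x| ≤ M) :
    |∫ x, g x * ‖φ x‖ ^ 2| ≤ M * ∫ x, ‖φ x‖ ^ 2 := by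
  have h1 := hφ.integral_weight_mul_norm_sq_le hU hg (h := fun _ => M) contDiffOn_const
    fun x hx => (abs_le.1 (hM x hx)).2
  have h2 := hφ.integral_weight_mul_norm_sq_le hU (g := fun _ => -M) contDiffOn_const hg
    fun x hx => (abs_le.1 (hM x hx)).1
  rw [integral_const_mul] at h1 h2
  exact abs_le.2 ⟨by linarith, h1⟩

/-- A bilinear pairing with a bounded weight, estimated by `2|zw| ≤ |z|² + |w|²`. -/
theorem IsTestFunction.norm_integral_weight_mul_conj_le {φ χ g : E n → ℂ} {δ : ℝ}
    (hU : IsOpen U) (hφ : IsTestFunction U φ) (hχ : IsTestFunction U χ) (hδ : 0 ≤ δ)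
    (hg : ∀ x ∈ U, ‖g x‖ ≤ δ) :
    2 * ‖∫ x, g x * χ x * conj (φ x)‖ ≤ δ * ((∫ x, ‖χ x‖ ^ 2) + ∫ x, ‖φ x‖ ^ 2) := by
  have hi := (hχ.integrable_norm_sq hU).add (hφ.integrable_norm_sq hU)
  have h : ‖∫ x, g x * χ x * conj (φ x)‖ ≤ ∫ x, δ / 2 * (‖χ x‖ ^ 2 + ‖φ x‖ ^ 2) := by
    refine norm_integral_le_of_norm_le (hi.const_mul _)
      (Filter.Eventually.of_forall fun x => ?_)
    by_cases hx : x ∈ U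
    · rw [norm_mul, norm_mul, RCLike.norm_conj]
      have h1 := mul_le_mul_of_nonneg_right (hg x hx)
        (mul_nonneg (norm_nonneg (χ x)) (norm_nonneg (φ x)))
      have h2 := mul_nonneg hδ (sq_nonneg (‖χ x‖ - ‖φ x‖))
      linarith
    · simp [hφ.eq_zero hx, hχ.eq_zero hx]
  rw [integral_const_mul, integral_add (hχ.integrable_norm_sq hU) (hφ.integrable_norm_sq hU)] at h
  linarith

/-! ### Integration by parts along a real vector field -/

/-- The divergence `∑ₖ ∂ₖ bₖ` of a vector field `b`. -/
noncomputable def divergence (b : E n → E n) (x : E n) : ℝ :=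
  ∑ k : Fin n, fderiv ℝ (fun y => b y k) x (EuclideanSpace.single k 1)

theorem contDiffOn_divergence {b : E n → E n} (hU : IsOpen U) (hb : ContDiffOn ℝ ∞ b U) :
    ContDiffOn ℝ ∞ (divergence b) U :=
  ContDiffOn.sum fun k _ =>
    (((contDiffOn_euclidean.1 hb) k).fderiv_of_isOpen hU (m := ∞) (by simp)).clm_apply
      contDiffOn_const

/-- The formal adjoint differs from the operator by a zero order term: `X* = X - i div b`. -/
theorem firstOrderAdj_eq {b : E n → E n} {u : E n → ℂ} {x : E n}
    (hb : DifferentiableAt ℝ b x) (hu : DifferentiableAt ℝ u x) :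
    firstOrderAdj b u x = firstOrder b u x - Complex.I * (divergence b x : ℂ) * u x := by
  have hk : ∀ k : Fin n, fderiv ℝ (fun y => ((b y k : ℝ) : ℂ) * u y) x
      (EuclideanSpace.single k 1) = ((b x k : ℝ) : ℂ) * fderiv ℝ u x (EuclideanSpace.single k 1)
        + (fderiv ℝ (fun y => b y k) x (EuclideanSpace.single k 1) : ℂ) * u x := by
    intro k
    have h1 := (differentiableAt_euclidean.1 hb k).hasFDerivAt
    have h2 : HasFDerivAt (fun y => ((b y k : ℝ) : ℂ)) _ x :=
      Complex.ofRealCLM.hasFDerivAt.comp x h1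
    rw [(h2.fun_mul hu.hasFDerivAt).fderiv]
    simp [mul_comm]
  rw [firstOrderAdj, Finset.sum_congr rfl fun k _ => hk k, Finset.sum_add_distrib,
    ← fderiv_apply_eq_sum, ← Finset.sum_mul, firstOrder, divergence]
  push_cast
  ring

theorem firstOrder_ofReal_mul {b : E n → E n} {ψ : E n → ℝ} {u : E n → ℂ} {x : E n}
    (hψ : DifferentiableAt ℝ ψ x) (hu : DifferentiableAt ℝ u x) :
    firstOrder b (fun y => (ψ y : ℂ) * u y) x =
      (ψ x : ℂ) * firstOrder b u x - Complex.I * (fderiv ℝ ψ x (b x) : ℂ) * u x := by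
  have h2 : HasFDerivAt (fun y => ((ψ y : ℝ) : ℂ)) _ x :=
    Complex.ofRealCLM.hasFDerivAt.comp x hψ.hasFDerivAt
  rw [firstOrder, (h2.fun_mul hu.hasFDerivAt).fderiv]
  simp [firstOrder]
  ring

/-- Integration by parts against a real multiplier `ψ`: as `iX` is a real vector field, the
imaginary part of `(ψ X φ, φ)` involves no derivative of `φ`. -/
theorem IsTestFunction.two_mul_im_integral_firstOrder {b : E n → E n} {ψ : E n → ℝ} {φ : E n → ℂ}
    (hU : IsOpen U) (hb : ContDiffOn ℝ ∞ b U) (hψ : ContDiffOn ℝ ∞ ψ U)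
    (hφ : IsTestFunction U φ) :
    2 * (∫ x, (ψ x : ℂ) * DegenerateSolvability.firstOrder b φ x * conj (φ x)).im =
      ∫ x, (fderiv ℝ ψ x (b x) + ψ x * divergence b x) * ‖φ x‖ ^ 2 := by
  have hψc : ContDiffOn ℝ ∞ (fun x => (ψ x : ℂ)) U :=
    Complex.ofRealCLM.contDiff.comp_contDiffOn hψ
  have hg : ContDiffOn ℝ ∞ (fun x => fderiv ℝ ψ x (b x) + ψ x * divergence b x) U :=
    ((hψ.fderiv_of_isOpen hU (m := ∞) (by simp)).clm_apply hb).add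
      (hψ.mul (contDiffOn_divergence hU hb))
  have hparts := integral_firstOrder_mul_conj hU hb hφ (hφ.smul_coeff hU hψc)
  have hl : ∀ x, DegenerateSolvability.firstOrder b φ x * conj ((ψ x : ℂ) * φ x) =
      (ψ x : ℂ) * DegenerateSolvability.firstOrder b φ x * conj (φ x) := fun x => by
    rw [map_mul, Complex.conj_ofReal]; ring
  have hr : ∀ x, φ x * conj (DegenerateSolvability.firstOrderAdj b (fun y => (ψ y : ℂ) * φ y) x) =
      conj ((ψ x : ℂ) * DegenerateSolvability.firstOrder b φ x * conj (φ x)) + Complex.I *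
        (((fderiv ℝ ψ x (b x) + ψ x * divergence b x) * ‖φ x‖ ^ 2 : ℝ) : ℂ) := by
    intro x
    by_cases hx : x ∈ U
    · have hbx := (hb.contDiffAt (hU.mem_nhds hx)).differentiableAt (by simp)
      have hψx := (hψ.contDiffAt (hU.mem_nhds hx)).differentiableAt (by simp)
      have hφx := hφ.smooth.differentiable (by simp) x
      rw [firstOrderAdj_eq hbx ((hφ.smul_coeff hU hψc).smooth.differentiable (by simp) x),
        firstOrder_ofReal_mul hψx hφx]
      push_cast
      rw [← Complex.mul_conj']
      simp only [map_sub, map_mul, Complex.conj_I, Complex.conj_ofReal, Complex.conj_conj]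
      ring
    · simp [hφ.eq_zero hx]
  have hi : Integrable (fun x => (ψ x : ℂ) * DegenerateSolvability.firstOrder b φ x * conj (φ x)) :=
    ((hφ.firstOrder hU hb).smul_coeff hU hψc).integrable_mul hφ.conj
  have hic : Integrable (fun x =>
      conj ((ψ x : ℂ) * DegenerateSolvability.firstOrder b φ x * conj (φ x))) :=
    Complex.conjCLE.toContinuousLinearMap.integrable_comp hi
  have hgi : Integrable (fun x => Complex.I *
      (((fderiv ℝ ψ x (b x) + ψ x * divergence b x) * ‖φ x‖ ^ 2 : ℝ) : ℂ)) :=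
    (hφ.integrable_weight_mul_norm_sq hU hg).ofReal.const_mul _
  simp only [hl, hr] at hparts
  rw [integral_add hic hgi, integral_conj,
    integral_const_mul, integral_complex_ofReal] at hparts
  have := congrArg Complex.im hparts
  simp only [Complex.add_im, Complex.conj_im, Complex.mul_im, Complex.I_re, Complex.I_im,
    Complex.ofReal_re, Complex.ofReal_im] at this
  linarith

/-- Poincaré inequality for a vector field `b` along which some `ψ` with `|ψ| ≤ δ` grows at a
rate at least `c`: if `δ` is small compared with `c`, then `‖φ‖² ≤ (2δ/c) ‖Xφ‖²`. -/
theorem IsTestFunction.mul_integral_norm_sq_le_firstOrder {b : E n → E n} {ψ : E n → ℝ}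
    {φ : E n → ℂ} {c δ M : ℝ} (hU : IsOpen U) (hb : ContDiffOn ℝ ∞ b U)
    (hψ : ContDiffOn ℝ ∞ ψ U) (hφ : IsTestFunction U φ) (hδ : 0 ≤ δ)
    (hc : ∀ x ∈ U, c ≤ fderiv ℝ ψ x (b x)) (hψδ : ∀ x ∈ U, |ψ x| ≤ δ)
    (hM : ∀ x ∈ U, |divergence b x| ≤ M) (hδc : δ * (M + 1) ≤ c / 2) :
    c * ∫ x, ‖φ x‖ ^ 2 ≤ 2 * δ * ∫ x, ‖DegenerateSolvability.firstOrder b φ x‖ ^ 2 := by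
  have hA : 0 ≤ ∫ x, ‖φ x‖ ^ 2 := integral_nonneg fun x => sq_nonneg _
  have h1 := hφ.integral_weight_mul_norm_sq_le hU (g := fun _ => c - δ * M)
    (h := fun x => fderiv ℝ ψ x (b x) + ψ x * divergence b x) contDiffOn_const
    (((hψ.fderiv_of_isOpen hU (m := ∞) (by simp)).clm_apply hb).add
      (hψ.mul (contDiffOn_divergence hU hb))) fun x hx => by
        have h := abs_mul (ψ x) (divergence b x)
        have h' := mul_le_mul (hψδ x hx) (hM x hx) (abs_nonneg _) hδ
        have := neg_abs_le (ψ x * divergence b x)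
        linarith [hc x hx]
  rw [integral_const_mul, ← hφ.two_mul_im_integral_firstOrder hU hb hψ] at h1
  have h2 := hφ.norm_integral_weight_mul_conj_le hU (hφ.firstOrder hU hb) hδ
    (g := fun x => (ψ x : ℂ)) fun x hx => by
      rw [Complex.norm_real]
      exact hψδ x hx
  have h3 := Complex.abs_im_le_norm
    (∫ x, (ψ x : ℂ) * DegenerateSolvability.firstOrder b φ x * conj (φ x))
  have h4 := le_abs_self (∫ x, (ψ x : ℂ) * DegenerateSolvability.firstOrder b φ x * conj (φ x)).im
  have h5 := mul_le_mul_of_nonneg_right hδc hA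
  linarith

/-! ### From an a priori estimate to solvability in a Hilbert space -/

/-- If `‖Lφ‖ ≤ C ‖Aφ‖`, the functional `Aφ ↦ (v, Lφ)` is well defined and bounded on the range
of `A`, so that it is represented by some `u`. -/
theorem exists_inner_eq_of_norm_le {V H : Type*} [AddCommGroup V] [Module ℂ V]
    [NormedAddCommGroup H] [InnerProductSpace ℂ H] [CompleteSpace H] (L A : V →ₗ[ℂ] H) {C : ℝ}
    (h : ∀ φ, ‖L φ‖ ≤ C * ‖A φ‖) (v : H) :
    ∃ u : H, ∀ φ, inner ℂ (A φ) u = inner ℂ (L φ) v := by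
  let l : V →ₗ[ℂ] ℂ := (innerSL ℂ v).toLinearMap ∘ₗ L
  have hl : ∀ φ, l φ = inner ℂ v (L φ) := fun φ => rfl
  have hker : LinearMap.ker A ≤ LinearMap.ker l := by
    intro φ hφ
    have h0 := h φ
    rw [LinearMap.mem_ker.1 hφ, norm_zero, mul_zero] at h0
    rw [LinearMap.mem_ker, hl, norm_le_zero_iff.1 h0, inner_zero_right]
  let g : LinearMap.range A →ₗ[ℂ] ℂ :=
    (LinearMap.ker A).liftQ l hker ∘ₗ A.quotKerEquivRange.symm.toLinearMap
  have hg : ∀ φ, g ⟨A φ, LinearMap.mem_range_self A φ⟩ = l φ := by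
    intro φ
    have : A.quotKerEquivRange.symm ⟨A φ, LinearMap.mem_range_self A φ⟩ =
        (LinearMap.ker A).mkQ φ := A.quotKerEquivRange_symm_apply_image φ _
    simp only [g, LinearMap.comp_apply, LinearEquiv.coe_coe, this]
    exact Submodule.liftQ_apply _ _ _
  have hbound : ∀ y, ‖g y‖ ≤ ‖v‖ * C * ‖y‖ := by
    rintro ⟨_, φ, rfl⟩
    rw [hg, hl, mul_assoc]
    exact (norm_inner_le_norm _ _).trans (mul_le_mul_of_nonneg_left (h φ) (norm_nonneg _))
  obtain ⟨G, hG, -⟩ := exists_extension_norm_eq (LinearMap.range A) (g.mkContinuous _ hbound)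
  refine ⟨(InnerProductSpace.toDual ℂ H).symm G, fun φ => ?_⟩
  rw [← inner_conj_symm, InnerProductSpace.toDual_symm_apply,
    hG ⟨A φ, LinearMap.mem_range_self A φ⟩, LinearMap.mkContinuous_apply, hg, hl, inner_conj_symm]

/-! ### Linearity of the formal adjoint on test functions -/

theorem IsTestFunction.add {φ χ : E n → ℂ} (hφ : IsTestFunction U φ) (hχ : IsTestFunction U χ) :
    IsTestFunction U (φ + χ) :=
  ⟨hφ.smooth.add hχ.smooth, hφ.compact.add hχ.compact,
    (tsupport_add φ χ).trans (union_subset hφ.supp hχ.supp)⟩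

theorem IsTestFunction.const_smul {φ : E n → ℂ} (hφ : IsTestFunction U φ) (c : ℂ) :
    IsTestFunction U (c • φ) :=
  ⟨contDiff_const.smul hφ.smooth, hφ.compact.smul_left,
    (tsupport_smul_subset_right (fun _ => c) φ).trans hφ.supp⟩

/-- The space `C₀^∞(U)`. -/
def testFunctions (U : Set (E n)) : Submodule ℂ (E n → ℂ) where
  carrier := {φ | IsTestFunction U φ}
  add_mem' := IsTestFunction.add
  zero_mem' := ⟨contDiff_const, HasCompactSupport.zero, by simp [tsupport]⟩
  smul_mem' c _ hφ := hφ.const_smul c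

theorem IsTestFunction.memLp {φ : E n → ℂ} (hφ : IsTestFunction U φ) :
    MemLp φ 2 (volume : Measure (E n)) :=
  hφ.smooth.continuous.memLp_of_hasCompactSupport hφ.compact

theorem firstOrder_add {b : E n → E n} {u w : E n → ℂ} (hu : Differentiable ℝ u)
    (hw : Differentiable ℝ w) : firstOrder b (u + w) = firstOrder b u + firstOrder b w := by
  funext x
  simp [firstOrder, fderiv_add (hu x) (hw x), mul_add]

theorem firstOrder_const_smul {b : E n → E n} {u : E n → ℂ} (hu : Differentiable ℝ u) (c : ℂ) :
    firstOrder b (c • u) = c • firstOrder b u := by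
  funext x
  simp [firstOrder, fderiv_const_smul (hu x) c]
  ring

theorem IsTestFunction.firstOrderAdj_add {b : E n → E n} {φ χ : E n → ℂ} (hU : IsOpen U)
    (hb : ContDiffOn ℝ ∞ b U) (hφ : IsTestFunction U φ) (hχ : IsTestFunction U χ) :
    DegenerateSolvability.firstOrderAdj b (φ + χ) =
      DegenerateSolvability.firstOrderAdj b φ + DegenerateSolvability.firstOrderAdj b χ := by
  have hd : ∀ {χ : E n → ℂ}, IsTestFunction U χ → ∀ k x,
      DifferentiableAt ℝ (fun y => ((b y k : ℝ) : ℂ) * χ y) x := fun hχ k x =>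
    (hχ.smul_coeff hU (contDiffOn_coeff hb k)).smooth.differentiable (by simp) x
  funext x
  simp only [DegenerateSolvability.firstOrderAdj, Pi.add_apply, mul_add,
    fderiv_fun_add (hd hφ _ x) (hd hχ _ x), _root_.add_apply, Finset.sum_add_distrib]

theorem IsTestFunction.firstOrderAdj_const_smul {b : E n → E n} {φ : E n → ℂ} (hU : IsOpen U)
    (hb : ContDiffOn ℝ ∞ b U) (hφ : IsTestFunction U φ) (c : ℂ) :
    DegenerateSolvability.firstOrderAdj b (c • φ) =
      c • DegenerateSolvability.firstOrderAdj b φ := by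
  have hd : ∀ k x, DifferentiableAt ℝ (fun y => ((b y k : ℝ) : ℂ) * φ y) x := fun k x =>
    (hφ.smul_coeff hU (contDiffOn_coeff hb k)).smooth.differentiable (by simp) x
  funext x
  simp only [DegenerateSolvability.firstOrderAdj, Pi.smul_apply, smul_eq_mul,
    mul_left_comm _ c, fderiv_const_mul (hd _ x), _root_.smul_apply,
    ← Finset.mul_sum]

namespace DegenerateOperator

theorem contDiffOn_pow (P : DegenerateOperator n N) (hUΩ : U ⊆ P.Ω) :
    ContDiffOn ℝ ∞ (fun y => ((P.f y : ℝ) : ℂ) ^ P.p) U :=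
  ((Complex.ofRealCLM.contDiff.comp_contDiffOn P.f_smooth).pow _).mono hUΩ

theorem isTestFunction_flux (P : DegenerateOperator n N) (hU : IsOpen U) (hUΩ : U ⊆ P.Ω)
    {φ : E n → ℂ} (hφ : IsTestFunction U φ) (j : Fin N) :
    IsTestFunction U (fun y => ((P.f y : ℝ) : ℂ) ^ P.p * firstOrder (P.b j.succ) φ y) :=
  (hφ.firstOrder hU ((P.b_smooth j.succ).mono hUΩ)).smul_coeff hU (P.contDiffOn_pow hUΩ)

theorem isTestFunction_adj (P : DegenerateOperator n N) (hU : IsOpen U) (hUΩ : U ⊆ P.Ω)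
    {φ : E n → ℂ} (hφ : IsTestFunction U φ) : IsTestFunction U (P.adj φ) := by
  have h1 := IsTestFunction.sum Finset.univ fun j _ =>
    (P.isTestFunction_flux hU hUΩ hφ j).firstOrderAdj hU ((P.b_smooth j.succ).mono hUΩ)
  have h2 := (hφ.firstOrderAdj hU ((P.b_smooth 0).mono hUΩ)).const_smul (-Complex.I)
  have h3 := hφ.smul_coeff hU
    (Complex.conjCLE.contDiff.comp_contDiffOn (P.a₀_smooth.mono hUΩ))
  convert (h1.add h2).add h3 using 1
  funext x
  simp [adj, sub_eq_add_neg]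

theorem adj_add (P : DegenerateOperator n N) (hU : IsOpen U) (hUΩ : U ⊆ P.Ω) {φ χ : E n → ℂ}
    (hφ : IsTestFunction U φ) (hχ : IsTestFunction U χ) :
    P.adj (φ + χ) = P.adj φ + P.adj χ := by
  have hj : ∀ j : Fin N, (fun y => ((P.f y : ℝ) : ℂ) ^ P.p * firstOrder (P.b j.succ) (φ + χ) y) =
      (fun y => ((P.f y : ℝ) : ℂ) ^ P.p * firstOrder (P.b j.succ) φ y) +
      (fun y => ((P.f y : ℝ) : ℂ) ^ P.p * firstOrder (P.b j.succ) χ y) := fun j => by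
    rw [firstOrder_add (hφ.smooth.differentiable (by simp)) (hχ.smooth.differentiable (by simp))]
    funext y
    simp [mul_add]
  funext x
  simp only [adj, hj, hφ.firstOrderAdj_add hU ((P.b_smooth 0).mono hUΩ) hχ,
    fun j => (P.isTestFunction_flux hU hUΩ hφ j).firstOrderAdj_add hU
      ((P.b_smooth (Fin.succ j)).mono hUΩ) (P.isTestFunction_flux hU hUΩ hχ j),
    Pi.add_apply, Finset.sum_add_distrib]
  ring

theorem adj_const_smul (P : DegenerateOperator n N) (hU : IsOpen U) (hUΩ : U ⊆ P.Ω)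
    {φ : E n → ℂ} (hφ : IsTestFunction U φ) (c : ℂ) : P.adj (c • φ) = c • P.adj φ := by
  have hj : ∀ j : Fin N, (fun y => ((P.f y : ℝ) : ℂ) ^ P.p * firstOrder (P.b j.succ) (c • φ) y) =
      c • (fun y => ((P.f y : ℝ) : ℂ) ^ P.p * firstOrder (P.b j.succ) φ y) := fun j => by
    rw [firstOrder_const_smul (hφ.smooth.differentiable (by simp))]
    funext y
    simp [mul_left_comm]
  funext x
  simp only [adj, hj, hφ.firstOrderAdj_const_smul hU ((P.b_smooth 0).mono hUΩ) c,
    fun j => (P.isTestFunction_flux hU hUΩ hφ j).firstOrderAdj_const_smul hU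
      ((P.b_smooth (Fin.succ j)).mono hUΩ) c,
    Pi.smul_apply, smul_eq_mul, ← Finset.mul_sum]
  ring

/-! ### The a priori estimate -/

/-- Energy identity: the real part of `(P*φ, φ)` is the degenerate Dirichlet form
`∑ⱼ ∫ f^p |Xⱼφ|²` up to terms of order zero. -/
theorem re_integral_adj_mul_conj (P : DegenerateOperator n N) (hU : IsOpen U) (hUΩ : U ⊆ P.Ω)
    {φ : E n → ℂ} (hφ : IsTestFunction U φ) :
    (∫ x, P.adj φ x * conj (φ x)).re =
      (∑ j : Fin N, ∫ x, P.f x ^ P.p * ‖firstOrder (P.b j.succ) φ x‖ ^ 2)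
        - (1 / 2) * (∫ x, divergence (P.b 0) x * ‖φ x‖ ^ 2)
        + ∫ x, (P.a₀ x).re * ‖φ x‖ ^ 2 := by
  have hb : ∀ j, ContDiffOn ℝ ∞ (P.b j) U := fun j => (P.b_smooth j).mono hUΩ
  have ha : ContDiffOn ℝ ∞ (fun x => conj (P.a₀ x)) U :=
    Complex.conjCLE.contDiff.comp_contDiffOn (P.a₀_smooth.mono hUΩ)
  have hsum : ∀ j ∈ (Finset.univ : Finset (Fin N)), Integrable (fun x =>
      firstOrderAdj (P.b j.succ) (fun y => ((P.f y : ℝ) : ℂ) ^ P.p *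
        firstOrder (P.b j.succ) φ y) x * conj (φ x)) := fun j _ =>
    ((P.isTestFunction_flux hU hUΩ hφ j).firstOrderAdj hU (hb j.succ)).integrable_mul hφ.conj
  have h0 : Integrable (fun x => -Complex.I * (firstOrderAdj (P.b 0) φ x * conj (φ x))) :=
    ((hφ.firstOrderAdj hU (hb 0)).integrable_mul hφ.conj).const_mul _
  have h2 : Integrable (fun x => conj (P.a₀ x) * φ x * conj (φ x)) :=
    (hφ.smul_coeff hU ha).integrable_mul hφ.conj
  have hj : ∀ j : Fin N, ∫ x, firstOrderAdj (P.b j.succ) (fun y => ((P.f y : ℝ) : ℂ) ^ P.p *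
        firstOrder (P.b j.succ) φ y) x * conj (φ x) =
      ((∫ x, P.f x ^ P.p * ‖firstOrder (P.b j.succ) φ x‖ ^ 2 : ℝ) : ℂ) := by
    intro j
    rw [integral_firstOrderAdj_mul_conj hU (hb j.succ) (P.isTestFunction_flux hU hUΩ hφ j) hφ,
      ← integral_complex_ofReal]
    refine integral_congr_ae (Filter.Eventually.of_forall fun x => ?_)
    simp only [mul_assoc, Complex.mul_conj']
    push_cast
    rfl
  have hX0 : ∫ x, firstOrderAdj (P.b 0) φ x * conj (φ x) =
      conj (∫ x, firstOrder (P.b 0) φ x * conj (φ x)) := by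
    rw [integral_firstOrderAdj_mul_conj hU (hb 0) hφ hφ, ← integral_conj]
    refine integral_congr_ae (Filter.Eventually.of_forall fun x => ?_)
    simp only [map_mul, Complex.conj_conj, mul_comm]
  have him := hφ.two_mul_im_integral_firstOrder hU (hb 0) (ψ := fun _ => 1) contDiffOn_const
  simp only [Complex.ofReal_one, one_mul, fderiv_fun_const, Pi.zero_apply,
    _root_.zero_apply, zero_add] at him
  have hre : (∫ x, conj (P.a₀ x) * φ x * conj (φ x)).re = ∫ x, (P.a₀ x).re * ‖φ x‖ ^ 2 := by
    refine (integral_re h2).symm.trans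
      (integral_congr_ae (Filter.Eventually.of_forall fun x => ?_))
    simp only [mul_assoc, Complex.mul_conj']
    rw [← Complex.ofReal_pow]
    exact (Complex.re_mul_ofReal _ _).trans (by rw [Complex.conj_re])
  have hx : ∀ x, P.adj φ x * conj (φ x) = (∑ j : Fin N, firstOrderAdj (P.b j.succ)
        (fun y => ((P.f y : ℝ) : ℂ) ^ P.p * firstOrder (P.b j.succ) φ y) x * conj (φ x))
      + -Complex.I * (firstOrderAdj (P.b 0) φ x * conj (φ x))
      + conj (P.a₀ x) * φ x * conj (φ x) := fun x => by
    rw [adj, ← Finset.sum_mul]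
    ring
  have h01 : Integrable (fun x => (∑ j : Fin N, firstOrderAdj (P.b j.succ)
        (fun y => ((P.f y : ℝ) : ℂ) ^ P.p * firstOrder (P.b j.succ) φ y) x * conj (φ x))
      + -Complex.I * (firstOrderAdj (P.b 0) φ x * conj (φ x))) :=
    (integrable_finsetSum _ hsum).add h0
  simp only [hx]
  rw [integral_add h01 h2,
    integral_add (integrable_finsetSum _ hsum) h0, integral_finsetSum _ hsum,
    integral_const_mul, hX0, Finset.sum_congr rfl fun j _ => hj j, Complex.add_re,
    Complex.add_re, hre, ← him, ← Complex.ofReal_sum, Complex.ofReal_re]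
  simp [sub_eq_add_neg]

/-- The a priori estimate `‖φ‖ ≤ C ‖P*φ‖` on `C₀^∞(U)`, for `U` open around a given point off
`S` and relatively compact in `Ω`. -/
theorem exists_apriori_estimate (P : DegenerateOperator n N) {x₀ : E n} (hx₀ : x₀ ∈ P.Ω \ P.S)
    {j₀ : Fin N} (hj₀ : P.b j₀.succ x₀ ≠ 0) :
    ∃ K : Set (E n), IsCompact K ∧ K ⊆ P.Ω ∧ x₀ ∈ interior K ∧ ∃ C : ℝ,
      ∀ φ, IsTestFunction (interior K) φ →
        ∫ x, ‖φ x‖ ^ 2 ≤ C * ∫ x, ‖P.adj φ x‖ ^ 2 := by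
  have hΩ : P.Ω ∈ nhds x₀ := P.isOpen.mem_nhds hx₀.1
  set e : E n := P.b j₀.succ x₀ with he
  set g₀ : ℝ := P.f x₀ ^ P.p with hg₀
  have hg₀' : 0 < g₀ ^ 2 := by
    have : P.f x₀ ≠ 0 := fun h => hx₀.2 ⟨hx₀.1, h⟩
    positivity
  have he' : 0 < ‖e‖ ^ 2 := by
    have := norm_pos_iff.2 hj₀
    positivity
  -- The coefficients are controlled on a fixed ball, which is shrunk afterwards.
  have hb : ContinuousAt (P.b j₀.succ) x₀ := (P.b_smooth j₀.succ).continuousOn.continuousAt hΩ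
  have hf : ContinuousAt P.f x₀ := P.f_smooth.continuousOn.continuousAt hΩ
  have hbe : ∀ᶠ x in nhds x₀, ‖e‖ ^ 2 / 2 < inner ℝ e (P.b j₀.succ x) :=
    (continuousAt_const.inner hb).eventually_const_lt (by
      change _ < inner ℝ e e
      rw [real_inner_self_eq_norm_sq]; linarith)
  have hfg : ∀ᶠ x in nhds x₀, g₀ ^ 2 / 2 < g₀ * P.f x ^ P.p :=
    (continuousAt_const.mul (hf.pow P.p)).eventually_const_lt (by
      change _ < g₀ * g₀
      linarith)
  obtain ⟨R, hR, hball⟩ := Metric.nhds_basis_closedBall.mem_iff.1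
    (Filter.inter_mem hΩ (Filter.inter_mem hbe hfg))
  have hKΩ : Metric.closedBall x₀ R ⊆ P.Ω := fun x hx => (hball hx).1
  have hK := isCompact_closedBall x₀ R
  obtain ⟨M₁, hM₁⟩ := hK.exists_bound_of_continuousOn
    ((contDiffOn_divergence P.isOpen (P.b_smooth j₀.succ)).continuousOn.mono hKΩ)
  obtain ⟨M₂, hM₂⟩ := hK.exists_bound_of_continuousOn
    ((contDiffOn_divergence P.isOpen (P.b_smooth 0)).continuousOn.mono hKΩ)
  obtain ⟨M₃, hM₃⟩ := hK.exists_bound_of_continuousOn (P.a₀_smooth.continuousOn.mono hKΩ)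
  have hxR : x₀ ∈ Metric.closedBall x₀ R := Metric.mem_closedBall_self hR.le
  have hM₁0 := (norm_nonneg _).trans (hM₁ x₀ hxR)
  have hM₂0 := (norm_nonneg _).trans (hM₂ x₀ hxR)
  have hM₃0 := (norm_nonneg _).trans (hM₃ x₀ hxR)
  -- `m` bounds the lower order terms of `g₀ Re (P*φ, φ)`; the multiplier `ψ` used below is at
  -- most `δ`, which makes the Poincaré constant absorb them.
  set m : ℝ := |g₀| * (M₂ + M₃ + 1) with hm
  have hm0 : 0 ≤ m := by positivity
  obtain ⟨δ, hδ, hδ1, hδ2⟩ : ∃ δ : ℝ, 0 < δ ∧ δ * (M₁ + 1) ≤ ‖e‖ ^ 2 / 2 / 2 ∧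
      16 * m * δ ≤ g₀ ^ 2 * ‖e‖ ^ 2 := by
    refine ⟨min (‖e‖ ^ 2 / 4 / (M₁ + 1)) (g₀ ^ 2 * ‖e‖ ^ 2 / (16 * m + 1)), by positivity, ?_, ?_⟩
    · have := min_le_left (‖e‖ ^ 2 / 4 / (M₁ + 1)) (g₀ ^ 2 * ‖e‖ ^ 2 / (16 * m + 1))
      have h := (le_div_iff₀ (by positivity)).1 this
      linarith
    · have := min_le_right (‖e‖ ^ 2 / 4 / (M₁ + 1)) (g₀ ^ 2 * ‖e‖ ^ 2 / (16 * m + 1))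
      have h := (le_div_iff₀ (by positivity)).1 this
      have h0 : 0 < min (‖e‖ ^ 2 / 4 / (M₁ + 1)) (g₀ ^ 2 * ‖e‖ ^ 2 / (16 * m + 1)) := by
        positivity
      linarith
  set r : ℝ := min R (δ / ‖e‖) with hr
  have hene : 0 < ‖e‖ := norm_pos_iff.2 hj₀
  have hr0 : 0 < r := by positivity
  have hrR : Metric.closedBall x₀ r ⊆ Metric.closedBall x₀ R :=
    Metric.closedBall_subset_closedBall (min_le_left _ _)
  refine ⟨Metric.closedBall x₀ r, isCompact_closedBall x₀ r, hrR.trans hKΩ,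
    Metric.ball_subset_interior_closedBall (Metric.mem_ball_self hr0),
    8 * δ * |g₀| / (g₀ ^ 2 * ‖e‖ ^ 2), fun φ hφ => ?_⟩
  set U := interior (Metric.closedBall x₀ r)
  have hU : IsOpen U := isOpen_interior
  have hUr : U ⊆ Metric.closedBall x₀ r := interior_subset
  have hUR : U ⊆ Metric.closedBall x₀ R := hUr.trans hrR
  have hUΩ : U ⊆ P.Ω := hUR.trans hKΩ
  have hbU : ∀ j, ContDiffOn ℝ ∞ (P.b j) U := fun j => (P.b_smooth j).mono hUΩ
  set A := ∫ x, ‖φ x‖ ^ 2 with hA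
  set B := ∫ x, ‖firstOrder (P.b j₀.succ) φ x‖ ^ 2 with hB
  set F := ∫ x, ‖P.adj φ x‖ ^ 2 with hF
  have hA0 : 0 ≤ A := integral_nonneg fun x => sq_nonneg _
  have hB0 : 0 ≤ B := integral_nonneg fun x => sq_nonneg _
  have poincare : ‖e‖ ^ 2 / 2 * A ≤ 2 * δ * B := by
    have hψ : ∀ x, HasFDerivAt (fun x => inner ℝ e (x - x₀)) (innerSL ℝ e) x := fun x =>
      (innerSL ℝ e).hasFDerivAt.comp x ((hasFDerivAt_id x).sub_const x₀)
    refine hφ.mul_integral_norm_sq_le_firstOrder hU (hbU _)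
      (ψ := fun x => inner ℝ e (x - x₀)) (M := M₁)
      (contDiff_const.inner ℝ (contDiff_id.sub contDiff_const)).contDiffOn hδ.le
      (fun x hx => ?_) (fun x hx => ?_) (fun x hx => hM₁ x (hUR hx)) hδ1
    · have hψx := (hψ x).fderiv
      rw [hψx]
      exact (hball (hUR hx)).2.1.le
    · refine (abs_real_inner_le_norm _ _).trans ?_
      have h1 : ‖x - x₀‖ ≤ δ / ‖e‖ :=
        (mem_closedBall_iff_norm.1 (hUr hx)).trans (min_le_right _ _)
      have h2 := (le_div_iff₀ hene).1 h1
      linarith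
  have energy : g₀ ^ 2 / 2 * B ≤ |g₀| * F / 2 + m * A := by
    have hfU : ContDiffOn ℝ ∞ (fun x => g₀ * P.f x ^ P.p) U :=
      contDiffOn_const.mul ((P.f_smooth.mono hUΩ).pow _)
    have hX : ∀ j : Fin N, g₀ ^ 2 / 2 * ∫ x, ‖firstOrder (P.b j.succ) φ x‖ ^ 2 ≤
        g₀ * ∫ x, P.f x ^ P.p * ‖firstOrder (P.b j.succ) φ x‖ ^ 2 := by
      intro j
      have h := (hφ.firstOrder hU (hbU j.succ)).integral_weight_mul_norm_sq_le hU
        (g := fun _ => g₀ ^ 2 / 2) contDiffOn_const hfU fun x hx => (hball (hUR hx)).2.2.le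
      simp only [mul_assoc] at h
      rwa [integral_const_mul, integral_const_mul] at h
    have hsum : g₀ ^ 2 / 2 * B ≤
        g₀ * ∑ j : Fin N, ∫ x, P.f x ^ P.p * ‖firstOrder (P.b j.succ) φ x‖ ^ 2 := by
      rw [Finset.mul_sum]
      refine (hX j₀).trans (Finset.single_le_sum (f := fun j : Fin N =>
        g₀ * ∫ x, P.f x ^ P.p * ‖firstOrder (P.b j.succ) φ x‖ ^ 2)
        (fun j _ => le_trans ?_ (hX j)) (Finset.mem_univ j₀))
      exact mul_nonneg (by positivity) (integral_nonneg fun x => sq_nonneg _)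
    have hd := hφ.abs_integral_weight_mul_norm_sq_le hU (contDiffOn_divergence hU (hbU 0))
      fun x hx => hM₂ x (hUR hx)
    have ha := hφ.abs_integral_weight_mul_norm_sq_le hU (g := fun x => (P.a₀ x).re)
      (Complex.reCLM.contDiff.comp_contDiffOn (P.a₀_smooth.mono hUΩ))
      fun x hx => (Complex.abs_re_le_norm _).trans (hM₃ x (hUR hx))
    have hQ := hφ.norm_integral_weight_mul_conj_le hU (P.isTestFunction_adj hU hUΩ hφ)
      zero_le_one (g := fun _ => 1) (fun x _ => by simp)
    simp only [one_mul] at hQ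
    have hQ' := Complex.abs_re_le_norm (∫ x, P.adj φ x * conj (φ x))
    have hid := P.re_integral_adj_mul_conj hU hUΩ hφ
    set Q := (∫ x, P.adj φ x * conj (φ x)).re
    set D := ∫ x, divergence (P.b 0) x * ‖φ x‖ ^ 2
    set G := ∫ x, (P.a₀ x).re * ‖φ x‖ ^ 2
    set T := ∑ j : Fin N, ∫ x, P.f x ^ P.p * ‖firstOrder (P.b j.succ) φ x‖ ^ 2
    have hT : |T| ≤ F / 2 + (M₂ + M₃ + 1) * A := by
      have hTe : T = Q + 1 / 2 * D - G := by linarith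
      rw [hTe, abs_le]
      have := abs_le.1 hd
      have := abs_le.1 ha
      have := abs_le.1 hQ'
      have := mul_nonneg hM₂0 hA0
      constructor <;> linarith
    have h1 := (le_abs_self (g₀ * T)).trans_eq (abs_mul g₀ T)
    have h2 := mul_le_mul_of_nonneg_left hT (abs_nonneg g₀)
    rw [hm]
    linarith
  rw [div_mul_eq_mul_div, le_div_iff₀ (by positivity)]
  have h1 := mul_le_mul_of_nonneg_left poincare hg₀'.le
  have h2 := mul_le_mul_of_nonneg_left energy hδ.le
  have h3 := mul_le_mul_of_nonneg_right hδ2 hA0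
  linarith

end DegenerateOperator

end DegenerateSolvability

/-! ### Local solvability -/

open DegenerateSolvability in
theorem theorem2p2 {n N : ℕ} (P : DegenerateSolvability.DegenerateOperator n N)
    (h : ∀ x₀ ∈ P.Ω \ P.S, ∃ j₀ : Fin N, P.b j₀.succ x₀ ≠ 0) :
    P.L2LocallySolvableIn (P.Ω \ P.S) := by
  intro x₀ hx₀
  obtain ⟨j₀, hj₀⟩ := h x₀ hx₀
  obtain ⟨K, hK, hKΩ, hxK, C, hC⟩ := P.exists_apriori_estimate hx₀ hj₀
  refine ⟨K, hK, hKΩ, hxK, fun v hv => ?_⟩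
  have hU : IsOpen (interior K) := isOpen_interior
  have hUΩ : interior K ⊆ P.Ω := interior_subset.trans hKΩ
  let L : testFunctions (interior K) →ₗ[ℂ] Lp ℂ 2 (volume : Measure (E n)) :=
    { toFun := fun φ => (IsTestFunction.memLp φ.2).toLp φ.1
      map_add' := fun _ _ => rfl
      map_smul' := fun _ _ => rfl }
  let A : testFunctions (interior K) →ₗ[ℂ] Lp ℂ 2 (volume : Measure (E n)) :=
    { toFun := fun φ => (P.isTestFunction_adj hU hUΩ φ.2).memLp.toLp (P.adj φ.1)
      map_add' := fun φ χ => by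
        rw [← MemLp.toLp_add]
        exact MemLp.toLp_congr _ _ (.of_eq (P.adj_add hU hUΩ φ.2 χ.2))
      map_smul' := fun c φ => by
        rw [RingHom.id_apply, ← MemLp.toLp_const_smul]
        exact MemLp.toLp_congr _ _ (.of_eq (P.adj_const_smul hU hUΩ φ.2 c)) }
  have hnorm : ∀ {w : E n → ℂ} (hw : MemLp w 2 (volume : Measure (E n))),
      ‖hw.toLp w‖ ^ 2 = ∫ x, ‖w x‖ ^ 2 := by
    intro w hw
    rw [← @inner_self_eq_norm_sq ℂ, L2.inner_def, ← integral_re (L2.integrable_inner _ _)]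
    refine integral_congr_ae ?_
    filter_upwards [hw.coeFn_toLp] with x hx
    rw [hx, inner_self_eq_norm_sq]
  have hLA : ∀ φ, ‖L φ‖ ≤ √C * ‖A φ‖ := by
    intro φ
    rw [← Real.sqrt_sq (norm_nonneg (A φ)), ← Real.sqrt_mul' _ (sq_nonneg _)]
    refine Real.le_sqrt_of_sq_le ?_
    have h1 : ‖L φ‖ ^ 2 = ∫ x, ‖φ.1 x‖ ^ 2 := hnorm (IsTestFunction.memLp φ.2)
    have h2 : ‖A φ‖ ^ 2 = ∫ x, ‖P.adj φ.1 x‖ ^ 2 :=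
      hnorm (P.isTestFunction_adj hU hUΩ φ.2).memLp
    rw [h1, h2]
    exact hC φ.1 φ.2
  have hvK : MemLp (K.indicator v) 2 (volume : Measure (E n)) :=
    (memLp_indicator_iff_restrict hK.measurableSet).2 (hv K hK hKΩ)
  obtain ⟨u, hu⟩ := exists_inner_eq_of_norm_le L A hLA (hvK.toLp _)
  refine ⟨u, fun K' _ _ => (Lp.memLp u).restrict K', fun φ hφ => ?_⟩
  have key := hu ⟨φ, hφ⟩
  rw [L2.inner_def, L2.inner_def] at key
  refine Eq.trans (integral_congr_ae ?_) (key.trans (integral_congr_ae ?_))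
  · filter_upwards [(P.isTestFunction_adj hU hUΩ hφ).memLp.coeFn_toLp] with x hx
    exact (congrArg (fun z => u x * conj z) hx.symm).trans (RCLike.inner_apply _ _).symm
  · filter_upwards [hφ.memLp.coeFn_toLp, hvK.coeFn_toLp] with x hx hvx
    refine (RCLike.inner_apply _ _).trans ?_
    rw [hvx, show (L ⟨φ, hφ⟩) x = φ x from hx]
    by_cases hxK : x ∈ K
    · rw [indicator_of_mem hxK]
    · simp [hφ.eq_zero fun h => hxK (interior_subset h)]
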